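/- Let $\mathcal L_{\mathrm{HA}}=\{\mathbf 0,\mathbf 1,\vee,\wedge,\to\}$ be the first-order language of Heyting algebras, and let $\mathcal V$ be a variety of Heyting algebras, that is, the class of all Heyting algebras satisfying some fixed set of identities between $\mathcal L_{\mathrm{HA}}$-terms; its members are called $\mathcal V$-algebras. Assume that $\mathcal V$ has the Finite Model Property: for every $\mathcal L_{\mathrm{HA}}$-term $t(\bar p)$, if $\exists\bar p\;t(\bar p)\neq\mathbf 1$ holds in some $\mathcal V$-algebra, then it holds in some finite $\mathcal V$-algebra. Let $A$ be a finite $\mathcal V$-algebra and let $\varphi$ be an existential $\mathcal L_{\mathrm{HA}}$-formula with parameters in $A$, that is, $\varphi$ is of the form $\exists\bar q\;\theta(\bar a,\bar q,\bar y)$ with $\theta$ a quantifier-free $\mathcal L_{\mathrm{HA}}$-formula, $\bar a$ a tuple of elements of $A$, and $\bar y$ a (possibly empty) tuple of free variables. (A formula is satisfied in an algebra if it holds there for some values of its free variables.) A Heyting algebra $B$ given with an injective homomorphism of Heyting algebras $A\to B$ is said to contain $A$, and the parameters are then interpreted in $B$ through this embedding. If $\varphi$ is satisfied in some $\mathcal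 V$-algebra containing $A$, then $\varphi$ is satisfied in some finite $\mathcal V$-algebra containing $A$. -/

import Mathlib

universe u v

/-- Function symbols of the language of Heyting algebras. -/
inductive HAFunc : ℕ → Type
  | bot : HAFunc 0
  | top : HAFunc 0
  | sup : HAFunc 2
  | inf : HAFunc 2
  | himp : HAFunc 2

/-- The first-order language `{0, 1, ∨, ∧, →}` of Heyting algebras (no relation symbol besides
equality). -/
def haLang : FirstOrder.Language.{0, 0} where
  Functions := HAFunc
  Relations := fun _ => Empty

/-- Every Heyting algebra is a structure for this language in the usual way. -/
instance haStructure (H : Type u) [HeytingAlgebra H] : haLang.Structure H where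
  funMap := fun {_} f =>
    match f with
    | HAFunc.bot => fun _ => ⊥
    | HAFunc.top => fun _ => ⊤
    | HAFunc.sup => fun x => x 0 ⊔ x 1
    | HAFunc.inf => fun x => x 0 ⊓ x 1
    | HAFunc.himp => fun x => x 0 ⇨ x 1
  RelMap := fun {_} r => Empty.elim r

/-- A class of Heyting algebras (in a fixed universe). -/
abbrev HAClass : Type (u + 1) := ∀ (H : Type u) [HeytingAlgebra H], Prop

/-- `V` is a variety of Heyting algebras: an equational class, i.e. the class of all Heyting
algebras which satisfy some set `E` of identities between terms. -/
def IsHAVariety (V : HAClass.{u}) : Prop :=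
  ∃ E : Set (haLang.Term ℕ × haLang.Term ℕ),
    ∀ (H : Type u) [HeytingAlgebra H],
      V H ↔ ∀ e ∈ E, ∀ a : ℕ → H, e.1.realize a = e.2.realize a

/-- The Finite Model Property: for every term `t`, if `∃ p, t(p) ≠ 1` holds in some algebra
of the class, then it holds in some finite algebra of the class. -/
def HasFiniteModelProperty (V : HAClass.{u}) : Prop :=
  ∀ t : haLang.Term ℕ,
    (∃ (H : Type u) (_ : HeytingAlgebra H), V H ∧ ∃ a : ℕ → H, t.realize a ≠ ⊤) →
    ∃ (H : Type u) (_ : HeytingAlgebra H), V H ∧ Finite H ∧ ∃ a : ℕ → H, t.realize a ≠ ⊤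

/-- A formula whose free symbols are parameters from `A` and possibly variables indexed by `ℕ`
is satisfied in `B`, where `A` is viewed inside `B` through `i`: it holds for some assignment of
its free variables in `B`, each parameter `a` being interpreted as `i a`. For a formula without
free variables this just says that it is true in `B`. -/
def SatisfiedOver {A : Type u} {B : Type v} [HeytingAlgebra B] (i : A → B)
    (φ : haLang.Formula (A ⊕ ℕ)) : Prop :=
  ∃ b : ℕ → B, φ.Realize (Sum.elim i b)

/-!
An existential formula only inspects finitely many equations between terms, so it is enough to
transfer the truth values of a finite set `S` of equations from a `V`-algebra `B` to a finite
`V`-algebra `C` (`exists_finite_agree`). Adding the diagram of the finite algebra `A` to `S`, that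
is, its operation tables and the equations `a = b` between its elements, some true and some false,
makes the parameters form a copy of `A` inside `C` (`exists_injective_heytingHom_of_agree`).

To transfer `S`, let `D` be a term expressing the conjunction of the equations of `S` which hold
in `B`. For each equation `s = t` of `S` failing in `B`, the term `D ⇨ (s ⇔ t)` is not `⊤` in `B`,
hence by the Finite Model Property it is not `⊤` in some finite `V`-algebra. Dividing that algebra
by the filter generated by the value of `D` gives a finite `V`-algebra in which `D` takes the
value `⊤` while `s = t` still fails (`exists_finite_realize_ne`). The product of these quotients,
one for each equation failing in `B`, is the algebra `C`; varieties are closed under quotients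
and products.
-/

open FirstOrder FirstOrder.Language Function

/-! ### Terms in Heyting algebras -/

section Terms

variable {α : Type*} {H K : Type*} [HeytingAlgebra H] [HeytingAlgebra K]

/-- The term `⊥`. -/
def botTerm (α : Type*) : haLang.Term α := Term.func (L := haLang) (l := 0) HAFunc.bot Fin.elim0

/-- The term `⊤`. -/
def topTerm (α : Type*) : haLang.Term α := Term.func (L := haLang) (l := 0) HAFunc.top Fin.elim0

/-- The term `s ⊔ t`. -/
def supTerm (s t : haLang.Term α) : haLang.Term α :=
  Term.func (L := haLang) (l := 2) HAFunc.sup ![s, t]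

/-- The term `s ⊓ t`. -/
def infTerm (s t : haLang.Term α) : haLang.Term α :=
  Term.func (L := haLang) (l := 2) HAFunc.inf ![s, t]

/-- The term `s ⇨ t`. -/
def himpTerm (s t : haLang.Term α) : haLang.Term α :=
  Term.func (L := haLang) (l := 2) HAFunc.himp ![s, t]

/-- The term `s ⇔ t`, whose value is `⊤` exactly where the identity `s = t` holds. -/
def bihimpTerm (e : haLang.Term α × haLang.Term α) : haLang.Term α :=
  infTerm (himpTerm e.2 e.1) (himpTerm e.1 e.2)

@[simp] lemma realize_botTerm (v : α → H) : (botTerm α).realize v = ⊥ := rfl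

@[simp] lemma realize_topTerm (v : α → H) : (topTerm α).realize v = ⊤ := rfl

@[simp] lemma realize_supTerm (s t : haLang.Term α) (v : α → H) :
    (supTerm s t).realize v = s.realize v ⊔ t.realize v := rfl

@[simp] lemma realize_infTerm (s t : haLang.Term α) (v : α → H) :
    (infTerm s t).realize v = s.realize v ⊓ t.realize v := rfl

@[simp] lemma realize_himpTerm (s t : haLang.Term α) (v : α → H) :
    (himpTerm s t).realize v = s.realize v ⇨ t.realize v := rfl

lemma realize_bihimpTerm_eq_top (e : haLang.Term α × haLang.Term α) (v : α → H) :
    (bihimpTerm e).realize v = ⊤ ↔ e.1.realize v = e.2.realize v := by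
  simp only [bihimpTerm, realize_infTerm, realize_himpTerm, inf_eq_top_iff, himp_eq_top_iff]
  exact ⟨fun h => le_antisymm h.2 h.1, fun h => ⟨h.ge, h.le⟩⟩

lemma realize_heytingHom (f : HeytingHom H K) (t : haLang.Term α) (v : α → H) :
    t.realize (f ∘ v) = f (t.realize v) := by
  induction t with
  | var a => rfl
  | func g ts ih =>
    simp only [Term.realize_func, ih]
    cases g
    · exact (map_bot f).symm
    · exact (map_top f).symm
    · exact (map_sup f _ _).symm
    · exact (map_inf f _ _).symm
    · exact (map_himp f _ _).symm

/-- Evaluation of terms in a product of Heyting algebras is coordinatewise. -/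
lemma realize_pi {ι : Type*} {C : ι → Type*} [∀ i, HeytingAlgebra (C i)] (t : haLang.Term α)
    (v : α → ∀ i, C i) (i : ι) : t.realize v i = t.realize fun a => v a i :=
  let p : HeytingHom (∀ i, C i) (C i) :=
    { toFun := fun x => x i
      map_sup' := fun _ _ => rfl
      map_inf' := fun _ _ => rfl
      map_bot' := rfl
      map_himp' := fun _ _ => rfl }
  (realize_heytingHom p t v).symm

/-- A finite conjunction of equations is expressed by a single term being `⊤`. -/
lemma exists_term_realize_eq_top_iff {S : Set (haLang.Term α × haLang.Term α)} (hS : S.Finite) :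
    ∃ D : haLang.Term α, ∀ (H : Type*) [HeytingAlgebra H] (v : α → H),
      D.realize v = ⊤ ↔ ∀ e ∈ S, e.1.realize v = e.2.realize v := by
  induction S, hS using Set.Finite.induction_on with
  | empty => exact ⟨topTerm α, by simp⟩
  | @insert e _ _ _ ih =>
    obtain ⟨D, hD⟩ := ih
    refine ⟨infTerm (bihimpTerm e) D, fun H _ v => ?_⟩
    rw [realize_infTerm, inf_eq_top_iff, realize_bihimpTerm_eq_top, hD, Set.forall_mem_insert]

end Terms

/-! ### Quotients by principal filters and closure properties of varieties -/

/-- The quotient of a Heyting algebra by the principal filter of `d`, realized on the interval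
below `d`. -/
lemma exists_surjective_heytingHom_eq_top_iff {H : Type u} [HeytingAlgebra H] (d : H) :
    ∃ (K : Type u) (_ : HeytingAlgebra K) (f : HeytingHom H K),
      Surjective f ∧ ∀ x, f x = ⊤ ↔ d ≤ x := by
  let _ : HeytingAlgebra (Set.Iic d) :=
    { (inferInstance : Lattice (Set.Iic d)), (inferInstance : BoundedOrder (Set.Iic d)) with
      himp := fun x y => ⟨(x.1 ⇨ y.1) ⊓ d, inf_le_right⟩
      compl := fun x => ⟨(x.1 ⇨ ⊥) ⊓ d, inf_le_right⟩
      himp_bot := fun _ => rfl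
      le_himp_iff := fun x y z => by
        change x.1 ≤ (y.1 ⇨ z.1) ⊓ d ↔ x.1 ⊓ y.1 ≤ z.1
        rw [le_inf_iff, le_himp_iff]
        exact and_iff_left x.2 }
  let f : HeytingHom H (Set.Iic d) :=
    { toFun := fun x => ⟨x ⊓ d, inf_le_right⟩
      map_sup' := fun x y => Subtype.ext (inf_sup_right x y d)
      map_inf' := fun x y => Subtype.ext (inf_inf_distrib_right x y d)
      map_bot' := Subtype.ext (bot_inf_eq d)
      map_himp' := fun x y => Subtype.ext <| by
        change (x ⇨ y) ⊓ d = (x ⊓ d ⇨ y ⊓ d) ⊓ d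
        refine le_antisymm (le_inf (le_himp_iff.2 (le_inf ?_ ?_)) inf_le_right)
          (le_inf (le_himp_iff.2 ?_) inf_le_right)
        · calc (x ⇨ y) ⊓ d ⊓ (x ⊓ d) ≤ (x ⇨ y) ⊓ x := inf_le_inf inf_le_left inf_le_left
            _ ≤ y := himp_inf_le
        · exact inf_le_right.trans inf_le_right
        · calc (x ⊓ d ⇨ y ⊓ d) ⊓ d ⊓ x = (x ⊓ d ⇨ y ⊓ d) ⊓ (x ⊓ d) := by
                rw [inf_assoc, inf_comm d x]
            _ ≤ y ⊓ d := himp_inf_le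
            _ ≤ y := inf_le_left }
  refine ⟨Set.Iic d, inferInstance, f, fun x => ⟨x.1, Subtype.ext (inf_eq_left.2 x.2)⟩,
    fun x => ?_⟩
  exact Subtype.ext_iff.trans inf_eq_right

lemma IsHAVariety.of_surjective {V : HAClass.{u}} (hV : IsHAVariety V) {H K : Type u}
    [HeytingAlgebra H] [HeytingAlgebra K] (f : HeytingHom H K) (hf : Surjective f) (hH : V H) :
    V K := by
  obtain ⟨E, hE⟩ := hV
  refine (hE K).2 fun e he a => ?_
  obtain ⟨b, rfl⟩ := hf.comp_left a
  rw [realize_heytingHom, realize_heytingHom, (hE H).1 hH e he b]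

lemma IsHAVariety.pi {V : HAClass.{u}} (hV : IsHAVariety V) {ι : Type} {C : ι → Type u}
    [∀ i, HeytingAlgebra (C i)] (hC : ∀ i, V (C i)) : V (∀ i, C i) := by
  obtain ⟨E, hE⟩ := hV
  refine (hE _).2 fun e he a => funext fun i => ?_
  rw [realize_pi, realize_pi]
  exact (hE (C i)).1 (hC i) e he _

/-! ### Transferring finitely many equations to a finite algebra -/

/-- A single failing equation `e` can be refuted in a finite algebra while keeping `D = ⊤`. -/
lemma exists_finite_realize_ne {V : HAClass.{u}} (hV : IsHAVariety V)
    (hfmp : HasFiniteModelProperty V) {B : Type u} [HeytingAlgebra B] (hB : V B) {b : ℕ → B}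
    {D : haLang.Term ℕ} (hD : D.realize b = ⊤) {e : haLang.Term ℕ × haLang.Term ℕ}
    (he : e.1.realize b ≠ e.2.realize b) :
    ∃ (C : Type u) (_ : HeytingAlgebra C) (c : ℕ → C), V C ∧ Finite C ∧
      D.realize c = ⊤ ∧ e.1.realize c ≠ e.2.realize c := by
  obtain ⟨H, _, hH, hfin, a, ha⟩ := hfmp (himpTerm D (bihimpTerm e)) ⟨B, _, hB, b, by
    rwa [realize_himpTerm, hD, top_himp, Ne, realize_bihimpTerm_eq_top]⟩
  obtain ⟨K, _, f, hf, htop⟩ := exists_surjective_heytingHom_eq_top_iff (D.realize a)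
  refine ⟨K, inferInstance, f ∘ a, hV.of_surjective f hf hH, Finite.of_surjective f hf, ?_, ?_⟩
  · rw [realize_heytingHom, htop]
  · rwa [Ne, ← realize_bihimpTerm_eq_top, realize_heytingHom, htop, ← himp_eq_top_iff,
      ← realize_himpTerm]

lemma exists_finite_agree_nat {V : HAClass.{u}} (hV : IsHAVariety V)
    (hfmp : HasFiniteModelProperty V) {S : Set (haLang.Term ℕ × haLang.Term ℕ)} (hS : S.Finite)
    {B : Type u} [HeytingAlgebra B] (hB : V B) (b : ℕ → B) :
    ∃ (C : Type u) (_ : HeytingAlgebra C) (c : ℕ → C), V C ∧ Finite C ∧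
      ∀ e ∈ S, e.1.realize c = e.2.realize c ↔ e.1.realize b = e.2.realize b := by
  obtain ⟨D, hD⟩ := exists_term_realize_eq_top_iff
    (hS.subset (Set.sep_subset S fun e => e.1.realize b = e.2.realize b))
  have hDb : D.realize b = ⊤ := (hD B b).2 fun e he => he.2
  let F : Set (haLang.Term ℕ × haLang.Term ℕ) := {e ∈ S | e.1.realize b ≠ e.2.realize b}
  have hF : Finite F := hS.subset (Set.sep_subset S _)
  choose C hC c hVC hfin hc hne using fun e : F => exists_finite_realize_ne hV hfmp hB hDb e.2.2
  refine ⟨∀ e, C e, inferInstance, fun n e => c e n, hV.pi hVC, inferInstance, fun e he => ?_⟩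
  refine ⟨fun h => ?_, fun h => funext fun i => ?_⟩
  · by_contra hn
    have := congrFun h ⟨e, he, hn⟩
    rw [realize_pi, realize_pi] at this
    exact hne ⟨e, he, hn⟩ this
  · rw [realize_pi, realize_pi]
    exact (hD (C i) (c i)).1 (hc i) e ⟨he, h⟩

lemma exists_finite_agree {V : HAClass.{u}} (hV : IsHAVariety V)
    (hfmp : HasFiniteModelProperty V) {α : Type*} [Countable α]
    {S : Set (haLang.Term α × haLang.Term α)} (hS : S.Finite)
    {B : Type u} [HeytingAlgebra B] (hB : V B) (b : α → B) :
    ∃ (C : Type u) (_ : HeytingAlgebra C) (c : α → C), V C ∧ Finite C ∧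
      ∀ e ∈ S, e.1.realize c = e.2.realize c ↔ e.1.realize b = e.2.realize b := by
  obtain ⟨g, hg⟩ := exists_injective_nat α
  obtain ⟨C, _, c, hVC, hfin, hc⟩ := exists_finite_agree_nat hV hfmp
    (hS.image fun e => (e.1.relabel g, e.2.relabel g)) hB (extend g b ⊥)
  refine ⟨C, inferInstance, c ∘ g, hVC, hfin, fun e he => ?_⟩
  simpa only [Term.realize_relabel, extend_comp hg] using hc _ (Set.mem_image_of_mem _ he)

/-! ### Diagrams and existential formulas -/

/-- The diagram of `A`, the element `a` being named by the variable `x a`: the tables of its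
operations, and all equations between two elements. The latter are included whether or not they
hold in `A`, since a valuation keeping their truth values is injective on `A`. -/
def diagramEquations {A : Type*} [HeytingAlgebra A] {α : Type*} (x : A → α) :
    Set (haLang.Term α × haLang.Term α) :=
  {(.var (x ⊥), botTerm α)} ∪
  (Set.range (fun p : A × A => (.var (x p.1), .var (x p.2))) ∪
  (Set.range (fun p : A × A => (.var (x (p.1 ⊔ p.2)), supTerm (.var (x p.1)) (.var (x p.2)))) ∪
  (Set.range (fun p : A × A => (.var (x (p.1 ⊓ p.2)), infTerm (.var (x p.1)) (.var (x p.2)))) ∪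
  Set.range fun p : A × A => (.var (x (p.1 ⇨ p.2)), himpTerm (.var (x p.1)) (.var (x p.2))))))

lemma finite_diagramEquations {A : Type*} [HeytingAlgebra A] [Finite A] {α : Type*} (x : A → α) :
    (diagramEquations x).Finite :=
  (Set.finite_singleton _).union <| (Set.finite_range _).union <| (Set.finite_range _).union <|
    (Set.finite_range _).union (Set.finite_range _)

lemma exists_injective_heytingHom_of_agree {A B C : Type*} [HeytingAlgebra A] [HeytingAlgebra B]
    [HeytingAlgebra C] {α : Type*} {x : A → α} {i : HeytingHom A B} (hi : Injective i)
    {b : α → B} (hb : b ∘ x = i) {c : α → C}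
    (h : ∀ e ∈ diagramEquations x,
      e.1.realize c = e.2.realize c ↔ e.1.realize b = e.2.realize b) :
    ∃ j : HeytingHom A C, Injective j ∧ ⇑j = c ∘ x := by
  have hbx : ∀ a, b (x a) = i a := congrFun hb
  refine ⟨⟨⟨⟨c ∘ x, fun p q => ?_⟩, fun p q => ?_⟩, ?_, fun p q => ?_⟩, fun p q hpq => ?_, rfl⟩
  · exact (h _ (.inr (.inr (.inl ⟨(p, q), rfl⟩)))).2 (by simp [hbx])
  · exact (h _ (.inr (.inr (.inr (.inl ⟨(p, q), rfl⟩))))).2 (by simp [hbx])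
  · exact (h _ (.inl rfl)).2 (by simp [hbx])
  · exact (h _ (.inr (.inr (.inr (.inr ⟨(p, q), rfl⟩))))).2 (by simp [hbx])
  · have := (h _ (.inr (.inl ⟨(p, q), rfl⟩))).1 hpq
    exact hi (by simpa [hbx] using this)

/-- The truth value of a quantifier-free formula depends on finitely many equations only. -/
lemma FirstOrder.Language.BoundedFormula.IsQF.exists_finite_equations {α : Type*} {n : ℕ}
    {φ : haLang.BoundedFormula α n} (hφ : φ.IsQF) :
    ∃ S : Set (haLang.Term (α ⊕ Fin n) × haLang.Term (α ⊕ Fin n)), S.Finite ∧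
      ∀ (B C : Type u) [HeytingAlgebra B] [HeytingAlgebra C]
        (b : α ⊕ Fin n → B) (c : α ⊕ Fin n → C),
        (∀ e ∈ S, e.1.realize c = e.2.realize c ↔ e.1.realize b = e.2.realize b) →
        (φ.Realize (c ∘ Sum.inl) (c ∘ Sum.inr) ↔ φ.Realize (b ∘ Sum.inl) (b ∘ Sum.inr)) := by
  induction hφ with
  | falsum => exact ⟨∅, Set.finite_empty, fun _ _ _ _ _ _ _ => Iff.rfl⟩
  | of_isAtomic h =>
    cases h with
    | equal s t =>
      refine ⟨{(s, t)}, Set.finite_singleton _, fun B C _ _ b c h => ?_⟩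
      simpa only [BoundedFormula.realize_bdEqual, Sum.elim_comp_inl_inr] using h _ rfl
    | rel R => exact Empty.elim R
  | imp _ _ ih₁ ih₂ =>
    obtain ⟨S₁, hS₁, h₁⟩ := ih₁
    obtain ⟨S₂, hS₂, h₂⟩ := ih₂
    refine ⟨S₁ ∪ S₂, hS₁.union hS₂, fun B C _ _ b c h => ?_⟩
    rw [BoundedFormula.realize_imp, BoundedFormula.realize_imp,
      h₁ B C b c fun e he => h e (.inl he), h₂ B C b c fun e he => h e (.inr he)]

/-- The theorem for bounded formulas, in which quantifiers can be stripped one at a time. -/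
lemma FirstOrder.Language.BoundedFormula.IsExistential.exists_finite_realize {V : HAClass.{u}}
    (hV : IsHAVariety V) (hfmp : HasFiniteModelProperty V) {A : Type u} [HeytingAlgebra A]
    [Finite A] {B : Type u} [HeytingAlgebra B] (hB : V B) {i : HeytingHom A B}
    (hi : Injective i) (b : ℕ → B) {n : ℕ} {φ : haLang.BoundedFormula (A ⊕ ℕ) n}
    (hφ : φ.IsExistential) (xs : Fin n → B) (h : φ.Realize (Sum.elim i b) xs) :
    ∃ (C : Type u) (_ : HeytingAlgebra C) (j : HeytingHom A C) (c : ℕ → C) (ys : Fin n → C),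
      V C ∧ Finite C ∧ Injective j ∧ φ.Realize (Sum.elim j c) ys := by
  induction hφ with
  | @of_isQF n _ hφ =>
    obtain ⟨S, hS, hSφ⟩ := hφ.exists_finite_equations
    let x : A → (A ⊕ ℕ) ⊕ Fin n := Sum.inl ∘ Sum.inl
    obtain ⟨C, _, w, hVC, hfin, hw⟩ := exists_finite_agree hV hfmp
      (hS.union (finite_diagramEquations x)) hB (Sum.elim (Sum.elim i b) xs)
    obtain ⟨j, hj, hjw⟩ := exists_injective_heytingHom_of_agree (x := x) hi rfl
      fun e he => hw e (.inr he)
    refine ⟨C, inferInstance, j, w ∘ Sum.inl ∘ Sum.inr, w ∘ Sum.inr, hVC, hfin, hj, ?_⟩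
    have hinl : Sum.elim j (w ∘ Sum.inl ∘ Sum.inr) = w ∘ Sum.inl := by
      rw [hjw]
      exact Sum.elim_comp_inl_inr (w ∘ Sum.inl)
    rw [hinl]
    exact (hSφ B C _ w fun e he => hw e (.inl he)).2 h
  | ex _ ih =>
    obtain ⟨a, ha⟩ := BoundedFormula.realize_ex.1 h
    obtain ⟨C, _, j, c, ys, hVC, hfin, hj, hr⟩ := ih _ ha
    refine ⟨C, inferInstance, j, c, Fin.init ys, hVC, hfin, hj,
      BoundedFormula.realize_ex.2 ⟨ys (Fin.last _), ?_⟩⟩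
    rwa [Fin.snoc_init_self]

theorem mainTheorem5 (V : HAClass.{u}) (hV : IsHAVariety V) (hfmp : HasFiniteModelProperty V)
    (A : Type u) [HeytingAlgebra A] [Finite A] (hA : V A)
    (φ : haLang.Formula (A ⊕ ℕ)) (hφ : φ.IsExistential)
    (hsat : ∃ (B : Type u) (_ : HeytingAlgebra B) (i : HeytingHom A B),
      V B ∧ Function.Injective i ∧ SatisfiedOver i φ) :
    ∃ (C : Type u) (_ : HeytingAlgebra C) (j : HeytingHom A C),
      V C ∧ Finite C ∧ Function.Injective j ∧ SatisfiedOver j φ := by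
  obtain ⟨B, _, i, hB, hi, b, hb⟩ := hsat
  obtain ⟨C, _, j, c, ys, hVC, hfin, hj, hc⟩ := hφ.exists_finite_realize hV hfmp hB hi b default hb
  refine ⟨C, inferInstance, j, hVC, hfin, hj, c, ?_⟩
  rwa [Subsingleton.elim ys default] at hc
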